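/- **Setting.** A measure-theoretic Bayesian network (MTBN) $M=(V,E,\{\mathcal X_v\}_{v\in V},\{K_v\}_{v\in V})$ consists of a digraph $(V,E)$ of any cardinality with no infinite ancestor chain $v_0\leftarrow v_1\leftarrow v_2\leftarrow\cdots$, an arbitrary measurable space $\mathcal X_v$ for each $v\in V$, and a probability kernel $K_v$ from $\prod_{u\in \mathrm{pa}(v)}\mathcal X_u$ to $\mathcal X_v$ for each $v\in V$, where $\mathrm{pa}(v)=\{u : (u,v)\in E\}$. For $U\subseteq V$ let $\mathcal X_U=\prod_{u\in U}\mathcal X_u$ with the product $\sigma$-algebra, and for $W\subseteq U$ let $\pi^U_W:\mathcal X_U\to\mathcal X_W$ be the projection. Let $\Lambda$ be the class of all $U\subseteq V$ with $\mathrm{pa}(v)\subseteq U$ for every $v\in U$. For a measure $\mu$ on $\mathcal X_W$ and a set $S$ disjoint from $W$ with $\mathrm{pa}(v)\subseteq W$ for all $v\in S$, write $\mu\otimes\prod_{v\in S}(\pi^W_{\mathrm{pa}(v)}\circ K_v)$ for the measure on $\mathcal X_W\times\mathcal X_S=\mathcal X_{W\cup S}$ given by $$B\mapsto\int \mu(dx)\int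 \Big(\bigotimes_{v\in S}K_v(\pi^W_{\mathrm{pa}(v)}(x),\cdot)\Big)(dy)\;1_B(x,y).$$ A *projective family* is a family $\{\mu_U:U\in\Lambda\}$ of probability measures $\mu_U$ on $\mathcal X_U$ such that $\mu_W(A)=\mu_U((\pi^U_W)^{-1}(A))$ for all $W\subseteq U$ in $\Lambda$ and all measurable $A\subseteq \mathcal X_W$. It is *consistent with $M$* if for all $W\subseteq U$ in $\Lambda$ with $\mathrm{pa}(u)\subseteq W$ for all $u\in U$, $$\mu_U=\mu_W\otimes\prod_{u\in U\setminus W}(\pi^W_{\mathrm{pa}(u)}\circ K_u).$$ Let $d(v)$ be the depth of $v$: the least ordinal with $d(u)<d(v)$ for every $u\in \mathrm{pa}(v)$ (defined by well-founded recursion). Put $D=\sup_{v\in V}(d(v)+1)$ and $U^\alpha=\{u\in U:d(u)<\alpha\}$, so that $U^D=U$. For $U\in\Lambda$ define measures $\mu_U^\alpha$ on $\mathcal X_{U^\alpha}$ by transfinite recursion: $\mu_U^0$ is the unit mass on the one-point space $\mathcal X_\emptyset$; $$\mu_U^{\alpha+1}=\mu_U^\alpha\otimes\prod_{v\in U:\,d(v)=\alpha}(\pi^{U^\alpha}_{\mathrm{pa}(v)}\circ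 K_v);$$ and for a limit ordinal $\lambda$, $\mu_U^\lambda=\lim_{\alpha<\lambda}\mu_U^\alpha$ is the unique measure on $\mathcal X_{U^\lambda}$ whose image under $\pi^{U^\lambda}_{U^\alpha}$ is $\mu_U^\alpha$ for every $\alpha<\lambda$. **Theorem.** This recursion is well defined: for every $U\in\Lambda$ and every limit ordinal $\lambda$, the image of $\mu_U^\beta$ under $\pi^{U^\beta}_{U^\alpha}$ is $\mu_U^\alpha$ for all $\alpha<\beta<\lambda$, and the limit $\lim_{\alpha<\lambda}\mu_U^\alpha$ exists and is unique. Moreover, $\{\mu_U^D:U\in\Lambda\}$ is a projective family of probability measures consistent with $M$, and it is the only projective family of probability measures consistent with $M$. -/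

import Mathlib

open MeasureTheory ProbabilityTheory

universe u w

/-- The product kernel `∏ i, κ i` of an arbitrary family of probability kernels with a common
source: at the point `t` it is the (possibly infinite) product measure `⨂ i, κ i t`. -/
noncomputable def kernelPi {T : Type*} [MeasurableSpace T] {ι : Type*} {Y : ι → Type*}
    [∀ i, MeasurableSpace (Y i)] (κ : ∀ i, Kernel T (Y i)) [∀ i, IsMarkovKernel (κ i)] :
    Kernel T (∀ i, Y i) where
  toFun t := Measure.infinitePi (fun i => κ i t)
  measurable' := by
    refine Measurable.measure_of_isPiSystem_of_isProbabilityMeasure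
      generateFrom_squareCylinders.symm
      (isPiSystem_squareCylinders (fun _ => MeasurableSpace.isPiSystem_measurableSet)
        (by simp)) ?_
    rintro _ ⟨s, t, ht, rfl⟩
    have ht' : ∀ i, MeasurableSet (t i) := fun i => ht i (Set.mem_univ i)
    simp_rw [Measure.infinitePi_pi _ (fun i _ => ht' i)]
    exact Finset.measurable_fun_prod s fun i _ => Kernel.measurable_coe (κ i) (ht' i)

instance {T : Type*} [MeasurableSpace T] {ι : Type*} {Y : ι → Type*}
    [∀ i, MeasurableSpace (Y i)] (κ : ∀ i, Kernel T (Y i)) [∀ i, IsMarkovKernel (κ i)] :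
    IsMarkovKernel (kernelPi κ) :=
  ⟨fun t => inferInstanceAs (IsProbabilityMeasure (Measure.infinitePi (fun i => κ i t)))⟩

/-- The canonical map `X_W × X_S → X_U` for `U = W ∪ S`. It is the usual identification when `W`
and `S` are disjoint, the only case in which it is used. -/
noncomputable def glue {V : Type u} {X : V → Type w} {W S U : Set V} (hU : U = W ∪ S)
    (p : (∀ v : W, X v) × (∀ v : S, X v)) : ∀ v : U, X v := by
  classical
  exact fun v => if h : v.1 ∈ W then p.1 ⟨v.1, h⟩
    else p.2 ⟨v.1, (hU ▸ v.2 : v.1 ∈ W ∪ S).resolve_left h⟩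

theorem measurable_glue {V : Type u} {X : V → Type w} [∀ v, MeasurableSpace (X v)]
    {W S U : Set V} (hU : U = W ∪ S) : Measurable (glue (X := X) hU) := by
  refine measurable_pi_lambda _ fun v => ?_
  by_cases h : v.1 ∈ W
  · simp only [glue, h, dite_true]
    fun_prop
  · simp only [glue, h, dite_false]
    fun_prop

/-- A measure-theoretic Bayesian network on the vertex set `V` (of any cardinality) with arbitrary
measurable spaces `X v`. `E u v` is the edge `u → v`; `no_chain` says that there is no infinite
ancestor chain `v₀ ← v₁ ← v₂ ← ⋯`; `K v` is a probability kernel from the product of the spaces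
of the parents of `v` to the space of `v`. -/
structure MTBN (V : Type u) (X : V → Type w) [∀ v, MeasurableSpace (X v)] where
  E : V → V → Prop
  no_chain : ¬ ∃ f : ℕ → V, ∀ n, E (f (n + 1)) (f n)
  K : ∀ v, Kernel (∀ u : {u : V | E u v}, X u) (X v)
  markov : ∀ v, IsMarkovKernel (K v)

namespace MTBN

variable {V : Type u} {X : V → Type w} [∀ v, MeasurableSpace (X v)] (M : MTBN V X)

/-- The set of parents of a vertex. -/
def pa (v : V) : Set V := {u : V | M.E u v}

instance (v : V) : IsMarkovKernel (M.K v) := M.markov v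

instance isWellFounded : IsWellFounded V M.E :=
  wellFounded_iff_isEmpty_descending_chain.2 ⟨fun f => M.no_chain ⟨f.1, f.2⟩⟩ |> fun h => ⟨h⟩

/-- The depth `d(v)`: the least ordinal larger than `d(u)` for every parent `u` of `v`. -/
noncomputable def depth (v : V) : Ordinal.{u} := IsWellFounded.rank M.E v

/-- `D = sup_v (d(v) + 1)`, the least strict upper bound on the depth. -/
noncomputable def D : Ordinal.{u} := ⨆ v, (M.depth v + 1)

theorem depth_lt_of_edge {a b : V} (h : M.E a b) : M.depth a < M.depth b :=
  IsWellFounded.rank_lt_of_rel h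

theorem depth_lt_D (v : V) : M.depth v < M.D :=
  lt_of_lt_of_le (Order.lt_add_one_iff.2 le_rfl)
    (Ordinal.le_iSup (fun v => M.depth v + 1) v)

/-- The class `Λ` of parent-closed (upwardly closed) vertex sets. -/
def Lam : Type u := {U : Set V // ∀ v ∈ U, M.pa v ⊆ U}

/-- `U^α`, the set of vertices of `U` of depth less than `α`. -/
def below (U : M.Lam) (α : Ordinal.{u}) : Set V := {v | v ∈ U.1 ∧ M.depth v < α}

/-- The set of vertices of `U` of depth exactly `α`. -/
def level (U : M.Lam) (α : Ordinal.{u}) : Set V := {v | v ∈ U.1 ∧ M.depth v = α}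

theorem below_mono (U : M.Lam) {α β : Ordinal.{u}} (h : α ≤ β) : M.below U α ⊆ M.below U β :=
  fun _ hv => ⟨hv.1, hv.2.trans_le h⟩

theorem below_succ (U : M.Lam) (α : Ordinal.{u}) :
    M.below U (α + 1) = M.below U α ∪ M.level U α := by
  ext v
  simp only [below, level, Set.mem_union, Set.mem_ofPred_eq, Order.lt_add_one_iff,
    le_iff_lt_or_eq]
  tauto

theorem pa_subset_below (U : M.Lam) (α : Ordinal.{u}) :
    ∀ v ∈ M.level U α, M.pa v ⊆ M.below U α :=
  fun v hv _ ha => ⟨U.2 v hv.1 ha, hv.2 ▸ M.depth_lt_of_edge ha⟩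

theorem subset_below_D (U : M.Lam) : U.1 ⊆ M.below U M.D :=
  fun v hv => ⟨hv, M.depth_lt_D v⟩

/-- The kernel `π^W_{pa(v)} ∘ K_v` from `X_W` to `X_v`, for `pa(v) ⊆ W`. -/
noncomputable def pullK {W : Set V} (v : V) (h : M.pa v ⊆ W) :
    Kernel (∀ a : W, X a) (X v) :=
  (M.K v).comap (Set.domRestrict₂ (π := X) h) (Set.measurable_restrict₂ h)

instance {W : Set V} (v : V) (h : M.pa v ⊆ W) : IsMarkovKernel (M.pullK v h) :=
  ⟨fun x => (M.markov v).isProbabilityMeasure (Set.domRestrict₂ (π := X) h x)⟩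

/-- The product kernel `∏_{v ∈ S} (π^W_{pa(v)} ∘ K_v)` from `X_W` to `X_S`. -/
noncomputable def prodK {W S : Set V} (h : ∀ v ∈ S, M.pa v ⊆ W) :
    Kernel (∀ a : W, X a) (∀ v : S, X v) :=
  kernelPi (fun v : S => M.pullK v.1 (h v.1 v.2))

/-- `μ ⊗ ∏_{v ∈ S} (π^W_{pa(v)} ∘ K_v)` as a measure on `X_U`, where `U` is the disjoint union
of `W` and `S`. -/
noncomputable def extend {W S U : Set V} (hU : U = W ∪ S) (h : ∀ v ∈ S, M.pa v ⊆ W)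
    (μ : Measure (∀ a : W, X a)) : Measure (∀ a : U, X a) :=
  (μ ⊗ₘ M.prodK h).map (glue hU)

/-- The measures `ν_α` on `X_{U^α}`, `α < o`, form a projective sequence. -/
def IsProjectiveSequence (U : M.Lam) (o : Ordinal.{u})
    (ν : ∀ α < o, Measure (∀ a : M.below U α, X a)) : Prop :=
  ∀ α β (hα : α < o) (hβ : β < o) (h : α < β),
    ν α hα = (ν β hβ).map (Set.domRestrict₂ (π := X) (M.below_mono U h.le))

/-- `ρ` is a limit of the measures `ν_α` on `X_{U^α}`, `α < o`: its marginal on `X_{U^α}` is `ν_α`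
for every `α < o`. (For a limit ordinal `o`, `U^o` is the union of the `U^α`, `α < o`.) -/
def IsLimit (U : M.Lam) (o : Ordinal.{u})
    (ν : ∀ α < o, Measure (∀ a : M.below U α, X a))
    (ρ : Measure (∀ a : M.below U o, X a)) : Prop :=
  ∀ α (hα : α < o), ν α hα = ρ.map (Set.domRestrict₂ (π := X) (M.below_mono U hα.le))

open Classical in
/-- The limit of the measures `ν_α`, `α < o`: the unique measure that is a limit of them (and the
junk value `0` if there is no such unique measure). -/
noncomputable def limitMeasure (U : M.Lam) (o : Ordinal.{u})
    (ν : ∀ α < o, Measure (∀ a : M.below U α, X a)) : Measure (∀ a : M.below U o, X a) :=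
  if h : ∃! ρ, M.IsLimit U o ν ρ then h.choose else 0

/-- The measures `μ_U^α` on `X_{U^α}`, by transfinite recursion on `α`:
`μ_U^0` is the unit mass on the one-point space `X_∅`,
`μ_U^{α+1} = μ_U^α ⊗ ∏_{v ∈ U, d(v) = α} (π^{U^α}_{pa(v)} ∘ K_v)`, and
`μ_U^o = lim_{α < o} μ_U^α` at a limit ordinal `o`. -/
noncomputable def muStage (U : M.Lam) (α : Ordinal.{u}) : Measure (∀ a : M.below U α, X a) :=
  Ordinal.limitRecOn (motive := fun α => Measure (∀ a : M.below U α, X a)) α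
    (Measure.dirac fun a => absurd a.2.2 not_lt_zero)
    (fun α μ => M.extend (M.below_succ U α) (M.pa_subset_below U α) μ)
    (fun o _ ν => M.limitMeasure U o ν)

/-- The family `μ_U = μ_U^D`, `U ∈ Λ`, read on `X_U` through `U^D = U`. -/
noncomputable def mu (U : M.Lam) : Measure (∀ a : U.1, X a) :=
  (M.muStage U M.D).map (Set.domRestrict₂ (π := X) (M.subset_below_D U))

/-- A projective family of probability measures on the spaces `X_U`, `U ∈ Λ`. -/
def IsProjectiveFamily (μ : ∀ U : M.Lam, Measure (∀ a : U.1, X a)) : Prop :=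
  (∀ U, IsProbabilityMeasure (μ U)) ∧
    ∀ (W U : M.Lam) (h : W.1 ⊆ U.1), μ W = (μ U).map (Set.domRestrict₂ (π := X) h)

/-- Consistency with the network: `μ_U = μ_W ⊗ ∏_{u ∈ U \ W} (π^W_{pa(u)} ∘ K_u)` whenever
`W ⊆ U` are in `Λ` and `W` contains the parents of all the vertices of `U`. -/
def IsConsistent (μ : ∀ U : M.Lam, Measure (∀ a : U.1, X a)) : Prop :=
  ∀ (W U : M.Lam) (h : W.1 ⊆ U.1) (hpa : ∀ u ∈ U.1, M.pa u ⊆ W.1),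
    μ U = M.extend (S := U.1 \ W.1) (Set.union_sdiff_cancel h).symm
      (fun u hu => hpa u hu.1) (μ W)

end MTBN

/-! All measures are realised on the one space of full configurations `∀ v, X v`, nonempty because
each kernel yields a point of `X v` from values at the parents. `resample S` redraws all vertices of
`S` at once from the old values of their parents; `cascade β S` redraws those of depth less than
`β`, depth by depth. From any starting configuration `x`, the measure `muStage U α` is the marginal
on `U^α` of `cascade α U x` (`muStage_eq_map_cascade`), so the theorem becomes a set of identities
between kernels.

Limits exist by an Ionescu-Tulcea argument (`exists_limit_measure`): the transitions from depth `α`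
to depth `β` compose and freeze the coordinates already drawn. Continuity at the empty set needs no
topology, since a decreasing sequence of events involves countably many stages, along which a point
of the intersection is built. Limits are unique because finitely many coordinates of depth below a
limit ordinal have depths bounded strictly below it.

Projectivity holds because a parent-closed set never reads the vertices outside it. Consistency
holds because vertices of `U \ W` are never parents in `U`, so their redrawing can be postponed and
done at once. Conversely, consistency for `U^α ⊆ U^(α+1)` and projectivity at limits force any such
family to follow the recursion. -/

/-! ### Kernels that redraw some coordinates and freeze the others. -/

section Resampling

open Filter Topology ENNReal

variable {V : Type u} {X : V → Type w}

/-- The configuration that agrees with `x` on `C` and with `y` off `C`. -/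
noncomputable def merge (C : Set V) (x y : ∀ v, X v) : ∀ v, X v := by
  classical
  exact fun v => if v ∈ C then x v else y v

theorem merge_of_mem {C : Set V} (x y : ∀ v, X v) {v : V} (h : v ∈ C) :
    merge C x y v = x v := by simp [merge, h]

theorem merge_of_notMem {C : Set V} (x y : ∀ v, X v) {v : V} (h : v ∉ C) :
    merge C x y v = y v := by simp [merge, h]

theorem merge_merge_of_subset {C C' : Set V} (h : C' ⊆ C) (x y : ∀ v, X v) :
    merge C' x (merge C x y) = merge C x y := by
  funext v
  by_cases hv : v ∈ C'
  · rw [merge_of_mem _ _ hv, merge_of_mem _ _ (h hv)]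
  · rw [merge_of_notMem _ _ hv]

theorem DependsOn.merge_mem_iff {E : Set (∀ v, X v)} {C : Set V}
    (hE : DependsOn (· ∈ E) C) (x y : ∀ v, X v) : merge C x y ∈ E ↔ x ∈ E :=
  iff_of_eq (hE fun _ hv => merge_of_mem x y hv)

theorem dependsOn_domRestrict (C : Set V) : DependsOn (C.domRestrict (π := X)) C :=
  fun _ _ h => funext fun v => h v v.2

theorem dependsOn_union {E F : Set (∀ v, X v)} {C : Set V} (hE : DependsOn (· ∈ E) C)
    (hF : DependsOn (· ∈ F) C) : DependsOn (· ∈ E ∪ F) C :=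
  fun _ _ h => congrArg₂ Or (hE h) (hF h)

theorem dependsOn_sdiff {E F : Set (∀ v, X v)} {C : Set V} (hE : DependsOn (· ∈ E) C)
    (hF : DependsOn (· ∈ F) C) : DependsOn (· ∈ E \ F) C :=
  fun _ _ h => congrArg₂ And (hE h) (congrArg Not (hF h))

theorem DependsOn.comp_merge_compl {Y : Type*} {f : (∀ v, X v) → Y} {C : Set V}
    (hf : DependsOn f C) (x y : ∀ v, X v) : f (merge Cᶜ x y) = f y :=
  hf fun _ hv => merge_of_notMem x y fun h => h hv

variable [∀ v, MeasurableSpace (X v)]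

theorem measurable_merge (C : Set V) (x : ∀ v, X v) : Measurable (merge C x) := by
  refine measurable_pi_lambda _ fun v => ?_
  by_cases h : v ∈ C
  · simp only [merge, h, if_true]
    fun_prop
  · simp only [merge, h, if_false]
    fun_prop

/-- A kernel on configurations fixes the coordinates in `C`: the new configuration is obtained from
the old one by resampling coordinates off `C` only. -/
def Fixes (κ : Kernel (∀ v, X v) (∀ v, X v)) (C : Set V) : Prop :=
  ∀ x, (κ x).map (merge C x) = κ x

theorem Fixes.mono {κ : Kernel (∀ v, X v) (∀ v, X v)} {C C' : Set V} (h : Fixes κ C)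
    (hC : C' ⊆ C) : Fixes κ C' := by
  intro x
  rw [← h x, Measure.map_map (measurable_merge _ _) (measurable_merge _ _)]
  exact congrArg (fun f => (κ x).map f) (funext (merge_merge_of_subset hC x))

theorem Fixes.lintegral_eq {κ : Kernel (∀ v, X v) (∀ v, X v)} {C : Set V} (h : Fixes κ C)
    (x : ∀ v, X v) {f : (∀ v, X v) → ℝ≥0∞} (hf : Measurable f) :
    ∫⁻ y, f y ∂κ x = ∫⁻ y, f (merge C x y) ∂κ x := by
  conv_lhs => rw [← h x]
  exact lintegral_map hf (measurable_merge _ _)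

theorem Fixes.apply_eq {κ : Kernel (∀ v, X v) (∀ v, X v)} [IsMarkovKernel κ] {C : Set V}
    (h : Fixes κ C) (x : ∀ v, X v) {E : Set (∀ v, X v)} (hE : MeasurableSet E)
    (hEC : DependsOn (· ∈ E) C) : κ x E = E.indicator 1 x := by
  rw [← h x, Measure.map_apply (measurable_merge _ _) hE]
  by_cases hx : x ∈ E
  · have : merge C x ⁻¹' E = Set.univ :=
      Set.eq_univ_of_forall fun y => (hEC.merge_mem_iff x y).2 hx
    simp [this, hx]
  · have : merge C x ⁻¹' E = ∅ :=
      Set.eq_empty_of_forall_notMem fun y hy => hx ((hEC.merge_mem_iff x y).1 hy)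
    simp [this, hx]

theorem Fixes.eq_id {κ : Kernel (∀ v, X v) (∀ v, X v)} [IsMarkovKernel κ]
    (h : Fixes κ Set.univ) : κ = Kernel.id := by
  ext x E hE
  rw [h.apply_eq x hE fun y z hyz => by rw [funext fun v => hyz v trivial], Kernel.id_apply,
    Measure.dirac_apply' _ hE]

/-- The intermediate configuration may be replaced by one that agrees with `x` on `C`; freezing `C`
at its values is then the same as freezing it at those of `x`. -/
theorem Fixes.comp {κ η : Kernel (∀ v, X v) (∀ v, X v)} {C : Set V}
    (hη : Fixes η C) (hκ : Fixes κ C) : Fixes (η ∘ₖ κ) C := by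
  intro x
  ext E hE
  have hE' := measurable_merge C x hE
  rw [Measure.map_apply (measurable_merge _ _) hE, Kernel.comp_apply' _ _ _ hE',
    Kernel.comp_apply' _ _ _ hE, hκ.lintegral_eq x (Kernel.measurable_coe η hE'),
    hκ.lintegral_eq x (Kernel.measurable_coe η hE)]
  refine lintegral_congr fun y => ?_
  rw [← hη (merge C x y), Measure.map_apply (measurable_merge _ _) hE',
    Measure.map_apply (measurable_merge _ _) hE]
  congr 1
  ext z
  have : merge C x (merge C (merge C x y) z) = merge C (merge C x y) z := by
    funext v
    by_cases hv : v ∈ C <;> simp [merge, hv]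
  simp only [Set.mem_preimage, this]

/-- The events that do not depend on the coordinates in `A i`, for some `i`. -/
def tailFreeEvents {ι : Type*} (A : ι → Set V) : Set (Set (∀ v, X v)) :=
  {E | MeasurableSet E ∧ ∃ i, DependsOn (· ∈ E) (A i)ᶜ}

theorem le_generateFrom_tailFreeEvents {ι : Type*} {A : ι → Set V} (hA : ∀ v, ∃ i, v ∉ A i) :
    MeasurableSpace.pi ≤ MeasurableSpace.generateFrom (tailFreeEvents (X := X) A) := by
  refine iSup_le fun v => ?_
  rintro _ ⟨t, ht, rfl⟩
  obtain ⟨i, hi⟩ := hA v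
  exact MeasurableSpace.measurableSet_generateFrom
    ⟨measurable_pi_apply v ht, i, fun x y h => congrArg (· ∈ t) (h v hi)⟩

/-! ### Ionescu-Tulcea along a linear order. -/

section Limit

variable {ι : Type*} [LinearOrder ι] {A : ι → Set V}
  {κ : ι → ι → Kernel (∀ v, X v) (∀ v, X v)} [∀ i j, IsMarkovKernel (κ i j)]

theorem isSetRing_tailFreeEvents [Nonempty ι] (hA : Antitone A) :
    IsSetRing (tailFreeEvents (X := X) A) where
  empty_mem := ⟨.empty, Classical.arbitrary ι, fun _ _ _ => rfl⟩
  union_mem := by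
    rintro E F ⟨hE, i, hi⟩ ⟨hF, j, hj⟩
    exact ⟨hE.union hF, max i j, dependsOn_union
      (hi.mono (Set.compl_subset_compl.2 (hA (le_max_left i j))))
      (hj.mono (Set.compl_subset_compl.2 (hA (le_max_right i j))))⟩
  sdiff_mem := by
    rintro E F ⟨hE, i, hi⟩ ⟨hF, j, hj⟩
    exact ⟨hE.diff hF, max i j, dependsOn_sdiff
      (hi.mono (Set.compl_subset_compl.2 (hA (le_max_left i j))))
      (hj.mono (Set.compl_subset_compl.2 (hA (le_max_right i j))))⟩

/-- From stage `i` on, only coordinates in `A i` are redrawn, and `E` ignores them. Hence the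
probability of `E` does not depend on the late stage at which it is read. -/
theorem kernel_apply_eq_of_le (hA : Antitone A)
    (hfix : ∀ i j, Fixes (κ i j) (A i \ A j)ᶜ)
    (hcomp : ∀ i j k, i ≤ j → j ≤ k → κ i k = κ j k ∘ₖ κ i j)
    {i j : ι} (hij : i ≤ j) {E : Set (∀ v, X v)} (hE : MeasurableSet E)
    (hEi : DependsOn (· ∈ E) (A i)ᶜ) (l : ι) (x : ∀ v, X v) :
    κ l j x E = κ l i x E := by
  have key : ∀ l m y, i ≤ l → κ l m y E = E.indicator 1 y := fun l m y hl =>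
    (hfix l m).apply_eq y hE (hEi.mono (Set.compl_subset_compl.2
      (Set.sdiff_subset.trans (hA hl))))
  rcases le_total l i with hl | hl
  · rw [hcomp l i j hl hij, Kernel.comp_apply' _ _ _ hE]
    simp_rw [key i j _ le_rfl]
    exact lintegral_indicator_one hE
  · rw [key l j x hl, key l i x hl]

/-- A decreasing sequence of events with empty intersection, each depending on the coordinates
off some `A i`, has probability tending to zero. -/
theorem iInf_kernel_apply_eq_zero (hA : Antitone A)
    (hfix : ∀ i j, Fixes (κ i j) (A i \ A j)ᶜ)
    (hcomp : ∀ i j k, i ≤ j → j ≤ k → κ i k = κ j k ∘ₖ κ i j)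
    {b : ι} (hb : ∀ i, b ≤ i) (x : ∀ v, X v) {s : ℕ → Set (∀ v, X v)} {j : ℕ → ι}
    (hj : Monotone j) (hs : ∀ n, MeasurableSet (s n))
    (hsj : ∀ n, DependsOn (· ∈ s n) (A (j n))ᶜ) (hanti : Antitone s) (hempty : ⋂ n, s n = ∅) :
    ⨅ n, κ b (j n) x (s n) = 0 := by
  by_contra hne
  -- `F i y` is the limiting probability of the events for the process started at `y` at stage `i`.
  -- Its positivity is carried from stage to stage.
  set F : ι → (∀ v, X v) → ℝ≥0∞ := fun i y => ⨅ n, κ i (j n) y (s n) with hF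
  have hFm : ∀ i, Measurable (F i) := fun i =>
    Measurable.iInf fun n => Kernel.measurable_coe (κ i (j n)) (hs n)
  have hmono : ∀ i y, Antitone fun n => κ i (j n) y (s n) := fun i y n m hnm => by
    change κ i (j m) y (s m) ≤ κ i (j n) y (s n)
    rw [← kernel_apply_eq_of_le hA hfix hcomp (hj hnm) (hs n) (hsj n) i y]
    exact measure_mono (hanti hnm)
  -- The bound `i' ≤ j N` ensures that the transition to `j n` factors through `i'` for all `n ≥ N`.
  have hstep : ∀ i i' N, i ≤ i' → i' ≤ j N → ∀ y, F i y ≠ 0 →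
      ∃ z, (∀ v ∉ A i \ A i', z v = y v) ∧ F i' z ≠ 0 := by
    intro i i' N hii' hN y hy
    have hle : F i y ≤ ∫⁻ z, F i' z ∂κ i i' y := by
      rw [hF, lintegral_iInf (fun n => Kernel.measurable_coe (κ i' (j n)) (hs n))
        (fun n m hnm z => hmono i' z hnm)
        (ne_top_of_le_ne_top ENNReal.one_ne_top ((lintegral_mono fun z => prob_le_one).trans
          (by simp)))]
      refine le_iInf fun n => (iInf_le _ (max n N)).trans ?_
      rw [hcomp i i' _ hii' (hN.trans (hj (le_max_right n N))), Kernel.comp_apply' _ _ _ (hs _)]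
      exact lintegral_mono fun z => hmono i' z (le_max_left n N)
    -- Merging with `y` inside the integral makes the point found agree with `y` exactly, not merely
    -- almost surely, at the frozen coordinates.
    rw [(hfix i i').lintegral_eq y (hFm i')] at hle
    by_contra! hcon
    refine hy (le_antisymm (hle.trans_eq ?_) zero_le)
    rw [lintegral_eq_zero_of_ae_eq_zero (.of_forall fun z => hcon _ fun v hv =>
      merge_of_mem _ _ hv)]
  obtain ⟨y₀, -, hy₀⟩ := hstep b (j 0) 0 (hb _) le_rfl x hne
  choose! g hg1 hg2 using fun n => hstep (j n) (j (n + 1)) (n + 1) (hj n.le_succ) le_rfl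
  let y : ℕ → ∀ v, X v := fun n => Nat.rec y₀ (fun n z => g n z) n
  have hy : ∀ n, F (j n) (y n) ≠ 0 := fun n => by
    induction n with
    | zero => exact hy₀
    | succ n ih => exact hg2 n _ ih
  have hys : ∀ n v, v ∉ A (j n) → y (n + 1) v = y n v := fun n v hv =>
    hg1 n _ (hy n) v fun h => hv h.1
  have hyc : ∀ n m, n ≤ m → ∀ v, v ∉ A (j n) → y m v = y n v := by
    intro n m hnm v hv
    induction m, hnm using Nat.le_induction with
    | base => rfl
    | succ m hnm ih => exact (hys m v fun h => hv (hA (hj hnm) h)).trans ih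
  -- The transition from `j n` to itself redraws nothing, so positivity of `F (j n)` at `y n` forces
  -- `y n` into `s n`.
  have hmem : ∀ n, y n ∈ s n := fun n => by
    by_contra hn
    refine hy n (le_antisymm ((iInf_le _ n).trans_eq ?_) zero_le)
    rw [(hfix (j n) (j n)).apply_eq _ (hs n) ((hsj n).mono (Set.compl_subset_compl.2
      Set.sdiff_subset)), Set.indicator_of_notMem hn]
  classical
  -- Each coordinate takes the value at which the sequence `y` has frozen it. A coordinate lying in
  -- every `A (j n)` affects none of the events, so `x v` is an arbitrary filler.
  let z : ∀ v, X v := fun v => if h : ∃ n, v ∉ A (j n) then y (Nat.find h) v else x v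
  have hz : ∀ n v, v ∉ A (j n) → z v = y n v := fun n v hv => by
    have h : ∃ n, v ∉ A (j n) := ⟨n, hv⟩
    simp only [z, dif_pos h]
    exact (hyc _ n (Nat.find_min' h hv) v (Nat.find_spec h)).symm
  have : z ∈ ⋂ n, s n := Set.mem_iInter.2 fun n =>
    (iff_of_eq (hsj n fun v hv => hz n v hv)).2 (hmem n)
  simp [hempty] at this

/-- The Ionescu-Tulcea theorem for a linearly ordered index set: the marginals of a projective
system of probability measures generated by kernels extend to a probability measure. -/
theorem exists_limit_measure (hA : Antitone A) (hA' : ∀ v, ∃ i, v ∉ A i)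
    (hfix : ∀ i j, Fixes (κ i j) (A i \ A j)ᶜ)
    (hcomp : ∀ i j k, i ≤ j → j ≤ k → κ i k = κ j k ∘ₖ κ i j)
    {b : ι} (hb : ∀ i, b ≤ i) (x : ∀ v, X v) :
    ∃ ρ : Measure (∀ v, X v), IsProbabilityMeasure ρ ∧ ∀ i E, MeasurableSet E →
      DependsOn (· ∈ E) (A i)ᶜ → ρ E = κ b i x E := by
  classical
  have : Nonempty ι := ⟨b⟩
  have hring := isSetRing_tailFreeEvents (X := X) hA
  let m : Set (∀ v, X v) → ℝ≥0∞ := fun E =>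
    if h : ∃ i, DependsOn (· ∈ E) (A i)ᶜ then κ b h.choose x E else 0
  have hm : ∀ i E, MeasurableSet E → DependsOn (· ∈ E) (A i)ᶜ → m E = κ b i x E := by
    intro i E hE hEi
    have h : ∃ i, DependsOn (· ∈ E) (A i)ᶜ := ⟨i, hEi⟩
    simp only [m, dif_pos h]
    rcases le_total h.choose i with hle | hle
    · exact (kernel_apply_eq_of_le hA hfix hcomp hle hE h.choose_spec b x).symm
    · exact kernel_apply_eq_of_le hA hfix hcomp hle hE hEi b x
  let c : AddContent ℝ≥0∞ (tailFreeEvents (X := X) A) := hring.addContent_of_union m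
    ((hm b ∅ .empty fun _ _ _ => rfl).trans measure_empty) <| by
      rintro E F ⟨hE, i, hi⟩ ⟨hF, j, hj⟩ hd
      replace hi := hi.mono (Set.compl_subset_compl.2 (hA (le_max_left i j)))
      replace hj := hj.mono (Set.compl_subset_compl.2 (hA (le_max_right i j)))
      rw [hm _ _ (hE.union hF) (dependsOn_union hi hj), hm _ _ hE hi, hm _ _ hF hj,
        measure_union hd hF]
  have hc : ∀ E, c E = m E := fun _ => rfl
  have htop : ∀ E ∈ tailFreeEvents (X := X) A, c E ≠ ∞ := by
    rintro E ⟨hE, i, hi⟩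
    rw [hc, hm i E hE hi]
    exact measure_ne_top _ _
  have hsub : c.IsSigmaSubadditive := by
    refine isSigmaSubadditive_of_addContent_iUnion_eq_tsum hring fun f hf hf_Union hf' =>
      addContent_iUnion_eq_sum_of_tendsto_zero hring c htop ?_ hf hf_Union hf'
    intro s hs hanti hempty
    choose hsm i hi using hs
    -- Partial suprema turn the chosen stages into a monotone sequence.
    have hsj : ∀ n, DependsOn (· ∈ s n) (A (partialSups i n))ᶜ := fun n =>
      (hi n).mono (Set.compl_subset_compl.2 (hA (le_partialSups i n)))
    have h0 := iInf_kernel_apply_eq_zero hA hfix hcomp hb x (partialSups i).monotone hsm hsj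
      hanti hempty
    have hcs : (fun n => c (s n)) = fun n => κ b (partialSups i n) x (s n) :=
      funext fun n => hm _ _ (hsm n) (hsj n)
    rw [hcs, ← h0]
    refine tendsto_atTop_iInf fun n k hnk => ?_
    change κ b (partialSups i k) x (s k) ≤ κ b (partialSups i n) x (s n)
    rw [← kernel_apply_eq_of_le hA hfix hcomp ((partialSups i).monotone hnk) (hsm n) (hsj n) b x]
    exact measure_mono (hanti hnk)
  have hgen := le_generateFrom_tailFreeEvents (X := X) hA'
  have hρ : ∀ i E, MeasurableSet E → DependsOn (· ∈ E) (A i)ᶜ →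
      c.measure hring.isSetSemiring hgen hsub E = κ b i x E := fun i E hE hEi => by
    rw [AddContent.measure_eq c hring.isSetSemiring
      (le_antisymm hgen (MeasurableSpace.generateFrom_le fun _ h => h.1)) hsub ⟨hE, i, hEi⟩, hc,
      hm i E hE hEi]
  exact ⟨_, ⟨by rw [hρ b _ .univ fun _ _ _ => rfl, measure_univ]⟩, hρ⟩

end Limit

end Resampling

/-! ### Comparing laws on a set of coordinates. -/

section Agreement

open ENNReal

variable {V : Type u} {X : V → Type w} [∀ v, MeasurableSpace (X v)]

theorem exists_limit_kernel {ι : Type*} [LinearOrder ι] {A : ι → Set V}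
    {κ : ι → ι → Kernel (∀ v, X v) (∀ v, X v)} [∀ i j, IsMarkovKernel (κ i j)]
    (hA : Antitone A) (hA' : ∀ v, ∃ i, v ∉ A i)
    (hfix : ∀ i j, Fixes (κ i j) (A i \ A j)ᶜ)
    (hcomp : ∀ i j k, i ≤ j → j ≤ k → κ i k = κ j k ∘ₖ κ i j)
    {b : ι} (hb : ∀ i, b ≤ i) :
    ∃ η : Kernel (∀ v, X v) (∀ v, X v), IsMarkovKernel η ∧ ∀ i x E, MeasurableSet E →
      DependsOn (· ∈ E) (A i)ᶜ → η x E = κ b i x E := by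
  have : Nonempty ι := ⟨b⟩
  choose ρ hρ h using exists_limit_measure hA hA' hfix hcomp hb
  refine ⟨⟨ρ, ?_⟩, ⟨hρ⟩, fun i x => h x i⟩
  refine Measurable.measure_of_isPiSystem_of_isProbabilityMeasure
    (le_antisymm (le_generateFrom_tailFreeEvents hA')
      (MeasurableSpace.generateFrom_le fun _ h => h.1))
    (isSetRing_tailFreeEvents hA).isSetSemiring.isPiSystem ?_
  rintro E ⟨hE, i, hi⟩
  simp_rw [h _ i E hE hi]
  exact Kernel.measurable_coe _ hE

/-- Two measures agree on the events that depend only on the coordinates in `C`. -/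
def AgreeOn (C : Set V) (μ ν : Measure (∀ v, X v)) : Prop :=
  ∀ E, MeasurableSet E → DependsOn (· ∈ E) C → μ E = ν E

theorem AgreeOn.mono {C C' : Set V} {μ ν : Measure (∀ v, X v)} (h : AgreeOn C μ ν)
    (hC : C' ⊆ C) : AgreeOn C' μ ν := fun E hE hEC => h E hE (hEC.mono hC)

theorem AgreeOn.symm {C : Set V} {μ ν : Measure (∀ v, X v)} (h : AgreeOn C μ ν) :
    AgreeOn C ν μ := fun E hE hEC => (h E hE hEC).symm

theorem AgreeOn.trans {C : Set V} {μ ν ρ : Measure (∀ v, X v)} (h : AgreeOn C μ ν)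
    (h' : AgreeOn C ν ρ) : AgreeOn C μ ρ := fun E hE hEC => (h E hE hEC).trans (h' E hE hEC)

theorem AgreeOn.eq {μ ν : Measure (∀ v, X v)} (h : AgreeOn Set.univ μ ν) : μ = ν :=
  Measure.ext fun E hE => h E hE fun y z hyz => by rw [funext fun v => hyz v trivial]

theorem AgreeOn.map_eq {C : Set V} {μ ν : Measure (∀ v, X v)} (h : AgreeOn C μ ν)
    {Y : Type*} [MeasurableSpace Y] {f : (∀ v, X v) → Y} (hf : Measurable f)
    (hfC : DependsOn f C) : μ.map f = ν.map f := by
  ext E hE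
  rw [Measure.map_apply hf hE, Measure.map_apply hf hE]
  exact h _ (hf hE) fun x y hxy => congrArg (· ∈ E) (hfC hxy)

theorem agreeOn_of_map_merge_eq {C : Set V} {μ ν : Measure (∀ v, X v)} (x : ∀ v, X v)
    (h : μ.map (merge Cᶜ x) = ν.map (merge Cᶜ x)) : AgreeOn C μ ν := by
  intro E hE hEC
  have hpre : merge Cᶜ x ⁻¹' E = E := Set.ext fun y => iff_of_eq (hEC.comp_merge_compl x y)
  have := congrArg (· E) h
  simpa only [Measure.map_apply (measurable_merge _ _) hE, hpre] using this

theorem AgreeOn.lintegral_eq {C : Set V} {μ ν : Measure (∀ v, X v)} (h : AgreeOn C μ ν)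
    {f : (∀ v, X v) → ℝ≥0∞} (hf : Measurable f) (hfC : DependsOn f C) :
    ∫⁻ x, f x ∂μ = ∫⁻ x, f x ∂ν := by
  calc ∫⁻ x, f x ∂μ = ∫⁻ a, id a ∂μ.map f := (lintegral_map measurable_id hf).symm
    _ = ∫⁻ a, id a ∂ν.map f := by rw [h.map_eq hf hfC]
    _ = ∫⁻ x, f x ∂ν := lintegral_map measurable_id hf

/-- Freezing the coordinates off `C` at a fixed `x` reduces the claim to uniqueness of projective
limits on the full product; among finitely many coordinates only those in `C` still vary. -/
theorem agreeOn_of_finset {C : Set V} {μ ν : Measure (∀ v, X v)} [IsProbabilityMeasure μ]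
    [IsProbabilityMeasure ν] (h : ∀ I : Finset V, (I : Set V) ⊆ C → AgreeOn (I : Set V) μ ν) :
    AgreeOn C μ ν := by
  classical
  obtain ⟨x⟩ := μ.nonempty_of_neZero
  have hm := measurable_merge Cᶜ x
  refine agreeOn_of_map_merge_eq x ?_
  have := Measure.isProbabilityMeasure_map (μ := ν) hm.aemeasurable
  refine IsProjectiveLimit.unique (P := fun I : Finset V => (ν.map (merge Cᶜ x)).map I.restrict)
    (fun I => ?_) fun I => rfl
  change _ = Measure.map I.restrict (ν.map (merge Cᶜ x))
  rw [Measure.map_map (Finset.measurable_restrict I) hm,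
    Measure.map_map (Finset.measurable_restrict I) hm]
  refine (h (I.filter (· ∈ C)) fun v hv => (Finset.mem_filter.1 hv).2).map_eq
    ((Finset.measurable_restrict I).comp hm) fun y z hyz => ?_
  funext v
  by_cases hv : v.1 ∈ C
  · simpa [merge, hv] using hyz v.1 (by simp [hv])
  · simp [merge, hv]

theorem infinitePi_congr {μ ν : ∀ v, Measure (X v)} [∀ v, IsProbabilityMeasure (μ v)]
    [∀ v, IsProbabilityMeasure (ν v)] (h : ∀ v, μ v = ν v) :
    Measure.infinitePi μ = Measure.infinitePi ν := by
  obtain rfl := funext h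
  rfl

theorem infinitePi_map_merge_eq_self {μ : ∀ v, Measure (X v)} [∀ v, IsProbabilityMeasure (μ v)]
    {C : Set V} {x : ∀ v, X v} (h : ∀ v ∈ C, μ v = Measure.dirac (x v)) :
    (Measure.infinitePi μ).map (merge C x) = Measure.infinitePi μ := by
  classical
  have hf : ∀ v, Measurable fun y : X v => if v ∈ C then x v else y := fun v => by
    split_ifs <;> fun_prop
  have := fun v => Measure.isProbabilityMeasure_map (μ := μ v) (hf v).aemeasurable
  have h1 : merge C x = fun y v => if v ∈ C then x v else y v := by
    funext y v
    by_cases hv : v ∈ C <;> simp [merge, hv]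
  rw [h1, Measure.infinitePi_map_pi μ (f := fun v y => if v ∈ C then x v else y) hf]
  refine infinitePi_congr fun v => ?_
  by_cases hv : v ∈ C
  · simp [hv, h v hv]
  · simp [hv]

theorem agreeOn_infinitePi {μ ν : ∀ v, Measure (X v)} [∀ v, IsProbabilityMeasure (μ v)]
    [∀ v, IsProbabilityMeasure (ν v)] {C : Set V} (h : ∀ v ∈ C, μ v = ν v) :
    AgreeOn C (Measure.infinitePi μ) (Measure.infinitePi ν) := by
  refine agreeOn_of_finset fun I hI E hE hEI => ?_
  obtain ⟨x⟩ := (Measure.infinitePi μ).nonempty_of_neZero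
  have key : ∀ ρ : ∀ v, Measure (X v), [∀ v, IsProbabilityMeasure (ρ v)] →
      Measure.infinitePi ρ E = Measure.pi (fun i : I => ρ i)
        ((fun (y : ∀ i : I, X i) v => open Classical in if h : v ∈ I then y ⟨v, h⟩ else x v) ⁻¹'
          E) := by
    intro ρ _
    rw [← Measure.infinitePi_map_restrict, Measure.map_apply (by fun_prop)]
    · congr 1
      ext y
      exact iff_of_eq (hEI fun v hv => by simp [Finset.mem_coe.1 hv])
    · refine (measurable_pi_lambda _ fun v => ?_) hE
      by_cases hv : v ∈ I
      · simp only [hv, dite_true]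
        fun_prop
      · simp only [hv, dite_false]
        fun_prop
  rw [key μ, key ν]
  have : (fun i : I => μ i) = fun i : I => ν i := funext fun i => h i (hI i.2)
  rw [this]

end Agreement

/-! ### Resampling vertices of the network, at once or by depth. -/

namespace MTBN

variable {V : Type u} {X : V → Type w} [∀ v, MeasurableSpace (X v)] (M : MTBN V X)

open Classical in
/-- The kernel for the new value of the vertex `v` when the vertices in `S` are resampled. -/
noncomputable def siteK (S : Set V) (v : V) : Kernel (∀ v, X v) (X v) :=
  if v ∈ S then (M.K v).comap (fun x u => x u) (by fun_prop)
  else Kernel.deterministic (fun x => x v) (measurable_pi_apply v)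

theorem siteK_of_mem {S : Set V} {v : V} (h : v ∈ S) (x : ∀ v, X v) :
    M.siteK S v x = M.K v fun u => x u := by
  simp [siteK, h, Kernel.comap_apply]

theorem siteK_of_notMem {S : Set V} {v : V} (h : v ∉ S) (x : ∀ v, X v) :
    M.siteK S v x = Measure.dirac (x v) := by
  simp [siteK, h, Kernel.deterministic_apply]

instance (S : Set V) (v : V) : IsMarkovKernel (M.siteK S v) := by
  unfold siteK
  split_ifs <;> infer_instance

/-- The kernel that resamples all the vertices in `S` at once, given the old values of their
parents. -/
noncomputable def resample (S : Set V) : Kernel (∀ v, X v) (∀ v, X v) := kernelPi (M.siteK S)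

instance (S : Set V) : IsMarkovKernel (M.resample S) :=
  inferInstanceAs (IsMarkovKernel (kernelPi _))

theorem resample_apply (S : Set V) (x : ∀ v, X v) :
    M.resample S x = Measure.infinitePi fun v => M.siteK S v x := rfl

theorem fixes_resample (S : Set V) : Fixes (M.resample S) Sᶜ := fun x =>
  infinitePi_map_merge_eq_self fun _ hv => M.siteK_of_notMem hv x

theorem agreeOn_resample {S S' C : Set V} {x y : ∀ v, X v}
    (h : ∀ v ∈ C, M.siteK S v x = M.siteK S' v y) :
    AgreeOn C (M.resample S x) (M.resample S' y) := agreeOn_infinitePi h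

theorem siteK_congr {S S' : Set V} {v : V} (hS : v ∈ S ↔ v ∈ S') {x y : ∀ v, X v}
    (hpa : v ∈ S → ∀ u ∈ M.pa v, x u = y u) (hv : v ∉ S → x v = y v) :
    M.siteK S v x = M.siteK S' v y := by
  by_cases h : v ∈ S
  · rw [M.siteK_of_mem h, M.siteK_of_mem (hS.1 h)]
    exact congrArg _ (funext fun u => hpa h u u.2)
  · rw [M.siteK_of_notMem h, M.siteK_of_notMem fun h' => h (hS.2 h'), hv h]

/-- The second draw does not see the first: on a box, the factors over `S` are constant in the
intermediate configuration, and the others integrate to the product over the remaining sites. A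
vertex in both sets is redrawn with the same law, so overlap is harmless. -/
theorem resample_comp_resample {S S' : Set V} (hpa : ∀ v ∈ S, Disjoint (M.pa v) S') :
    M.resample S ∘ₖ M.resample S' = M.resample (S ∪ S') := by
  classical
  ext1 x
  refine Measure.eq_infinitePi _ fun s t ht => ?_
  have hbox : ∀ s : Finset V, MeasurableSet (Set.pi (s : Set V) t) := fun s =>
    MeasurableSet.pi s.countable_toSet fun v _ => ht v
  rw [Kernel.comp_apply' _ _ _ (hbox s), (M.fixes_resample S').lintegral_eq x
    (Kernel.measurable_coe _ (hbox s))]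
  have h1 : ∀ y, M.resample S (merge S'ᶜ x y) (Set.pi (s : Set V) t) =
      (∏ v ∈ s with v ∈ S, M.siteK (S ∪ S') v x (t v)) *
        (Set.pi ((s.filter (· ∉ S) : Finset V) : Set V) t).indicator 1 (merge S'ᶜ x y) := by
    intro y
    rw [resample_apply, Measure.infinitePi_pi _ fun v _ => ht v,
      ← Finset.prod_filter_mul_prod_filter_not s (· ∈ S)]
    congr 1
    · refine Finset.prod_congr rfl fun v hv => ?_
      have hvS := (Finset.mem_filter.1 hv).2
      rw [M.siteK_congr (S := S) (S' := S ∪ S') (v := v) (y := x) (by simp [hvS])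
        (fun _ u hu => merge_of_mem (C := S'ᶜ) x y fun hu' => Set.disjoint_left.1 (hpa v hvS) hu hu')
        fun h => absurd hvS h]
    · rw [← Measure.dirac_apply' _ (hbox _), ← Measure.infinitePi_dirac,
        Measure.infinitePi_pi _ fun v _ => ht v]
      exact Finset.prod_congr rfl fun v hv => by
        rw [M.siteK_of_notMem (Finset.mem_filter.1 hv).2]
  simp_rw [h1]
  rw [lintegral_const_mul _ (f := fun y => Set.indicator _ 1 (merge S'ᶜ x y))
      ((measurable_one.indicator (hbox _)).comp (measurable_merge _ _)),
    ← (M.fixes_resample S').lintegral_eq x (measurable_one.indicator (hbox _)),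
    lintegral_indicator_one (hbox _), resample_apply, Measure.infinitePi_pi _ fun v _ => ht v,
    ← Finset.prod_filter_mul_prod_filter_not s (· ∈ S)]
  congr 1
  refine Finset.prod_congr rfl fun v hv => ?_
  rw [M.siteK_congr (S := S') (S' := S ∪ S') (y := x)
    (by simp [(Finset.mem_filter.1 hv).2]) (fun _ _ _ => rfl) fun _ => rfl]

/-- The vertices in `S` of depth in `[α, β)`. -/
def slice (S : Set V) (α β : Ordinal.{u}) : Set V := {v | v ∈ S ∧ α ≤ M.depth v ∧ M.depth v < β}

/-- The vertices in `S` of depth at least `α`. -/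
def above (S : Set V) (α : Ordinal.{u}) : Set V := {v | v ∈ S ∧ α ≤ M.depth v}

/-- The vertices in `S` of depth exactly `α`. -/
def layer (S : Set V) (α : Ordinal.{u}) : Set V := {v | v ∈ S ∧ M.depth v = α}

/-- `η` is a limit of the kernels `R α`, `α < o`, each of which resamples the vertices of `S` of
depth less than `α`. -/
def IsKernelLimit (S : Set V) (o : Ordinal.{u})
    (R : ∀ α < o, Kernel (∀ v, X v) (∀ v, X v)) (η : Kernel (∀ v, X v) (∀ v, X v)) : Prop :=
  IsMarkovKernel η ∧ ∀ α (hα : α < o) x, AgreeOn (M.slice S α o)ᶜ (η x) (R α hα x)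

open Classical in
/-- The kernel that resamples the vertices in `S` of depth less than `β` one depth after the
other. -/
noncomputable def cascade (β : Ordinal.{u}) : Set V → Kernel (∀ v, X v) (∀ v, X v) :=
  Ordinal.limitRecOn (motive := fun _ => Set V → Kernel (∀ v, X v) (∀ v, X v)) β
    (fun _ => Kernel.id)
    (fun α R S => M.resample (M.layer S α) ∘ₖ R S)
    (fun o _ R S => if h : ∃ η, M.IsKernelLimit S o (fun α hα => R α hα S) η then h.choose
      else Kernel.id)

theorem cascade_zero (S : Set V) : M.cascade 0 S = Kernel.id := by
  rw [cascade, Ordinal.limitRecOn_zero]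

theorem cascade_add_one (α : Ordinal.{u}) (S : Set V) :
    M.cascade (α + 1) S = M.resample (M.layer S α) ∘ₖ M.cascade α S := by
  rw [cascade, Ordinal.limitRecOn_add_one]
  rfl

theorem isKernelLimit_cascade {o : Ordinal.{u}} (ho : Order.IsSuccLimit o) {S : Set V}
    (h : ∃ η, M.IsKernelLimit S o (fun α _ => M.cascade α S) η) :
    M.IsKernelLimit S o (fun α _ => M.cascade α S) (M.cascade o S) := by
  have : M.cascade o S = h.choose := by
    rw [cascade, Ordinal.limitRecOn_limit _ _ _ _ ho]
    exact dif_pos h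
  rw [this]
  exact h.choose_spec

theorem above_above (S : Set V) {α β : Ordinal.{u}} (h : α ≤ β) :
    M.above (M.above S α) β = M.above S β := by
  ext v
  exact ⟨fun hv => ⟨hv.1.1, hv.2⟩, fun hv => ⟨⟨hv.1, h.trans hv.2⟩, hv.2⟩⟩

theorem above_zero (S : Set V) : M.above S 0 = S := by
  ext v
  simp [above]

theorem layer_above (S : Set V) {α β : Ordinal.{u}} (h : α ≤ β) :
    M.layer (M.above S α) β = M.layer S β := by
  ext v
  exact ⟨fun hv => ⟨hv.1.1, hv.2⟩, fun hv => ⟨⟨hv.1, h.trans hv.2.ge⟩, hv.2⟩⟩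

theorem exists_lt_forall_depth_lt {o : Ordinal.{u}} (ho : Order.IsSuccLimit o) (I : Finset V)
    {α : Ordinal.{u}} (hα : α < o) :
    ∃ β, α ≤ β ∧ β < o ∧ ∀ v ∈ I, M.depth v < o → M.depth v < β := by
  classical
  induction I using Finset.induction_on with
  | empty => exact ⟨α, le_rfl, hα, by simp⟩
  | insert v I _ ih =>
    obtain ⟨β, h1, h2, h3⟩ := ih
    by_cases hv : M.depth v < o
    · refine ⟨max β (M.depth v + 1), h1.trans (le_max_left _ _),
        max_lt h2 (ho.add_one_lt hv), fun w hw hwo => ?_⟩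
      rcases Finset.mem_insert.1 hw with rfl | hw
      · exact lt_max_of_lt_right (Order.lt_add_one_iff.2 le_rfl)
      · exact lt_max_of_lt_left (h3 w hw hwo)
    · refine ⟨β, h1, h2, fun w hw hwo => ?_⟩
      rcases Finset.mem_insert.1 hw with rfl | hw
      · exact absurd hwo hv
      · exact h3 w hw hwo

/-- Passage to a limit ordinal: finitely many coordinates avoid the depths in `[β, o)` for some `β <
o`, so events that ignore such a slice suffice. The lower bound `α` lets the test stages be taken
late. -/
theorem agreeOn_of_slice {o : Ordinal.{u}} (ho : Order.IsSuccLimit o) (S C : Set V)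
    {α : Ordinal.{u}} (hα : α < o) {μ ν : Measure (∀ v, X v)} [IsProbabilityMeasure μ]
    [IsProbabilityMeasure ν]
    (h : ∀ β, α ≤ β → β < o → AgreeOn (C \ M.slice S β o) μ ν) : AgreeOn C μ ν := by
  refine agreeOn_of_finset fun I hI => ?_
  obtain ⟨β, h1, h2, h3⟩ := M.exists_lt_forall_depth_lt ho I hα
  exact (h β h1 h2).mono fun v hv => ⟨hI hv, fun hv' => hv'.2.1.not_gt (h3 v hv hv'.2.2)⟩

/-- The properties of `cascade` that are established by transfinite induction. -/
structure CascadeSpec (β : Ordinal.{u}) : Prop where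
  markov : ∀ S, IsMarkovKernel (M.cascade β S)
  fixes : ∀ S, Fixes (M.cascade β S) (M.slice S 0 β)ᶜ
  comp : ∀ S α, α ≤ β → M.cascade β S = M.cascade β (M.above S α) ∘ₖ M.cascade α S

theorem cascade_above_self {β : Ordinal.{u}} (hm : ∀ S, IsMarkovKernel (M.cascade β S))
    (hf : ∀ S, Fixes (M.cascade β S) (M.slice S 0 β)ᶜ) (S : Set V) :
    M.cascade β (M.above S β) = Kernel.id := by
  refine Fixes.eq_id ((hf _).mono fun v _ hv => ?_)
  exact hv.1.2.not_gt hv.2.2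

theorem exists_isKernelLimit {o : Ordinal.{u}} (ho : Order.IsSuccLimit o)
    (ih : ∀ β < o, M.CascadeSpec β) (S : Set V) :
    ∃ η, M.IsKernelLimit S o (fun α _ => M.cascade α S) η := by
  -- The transition from depth `α` to depth `β` redraws only vertices of depth at least `α`. Its
  -- composition law is the induction hypothesis for `above S α`, which is why `CascadeSpec` ranges
  -- over all sets.
  let κ : Set.Iio o → Set.Iio o → Kernel (∀ v, X v) (∀ v, X v) :=
    fun α β => M.cascade β.1 (M.above S α.1)
  have hm : ∀ α β, IsMarkovKernel (κ α β) := fun α β => (ih β.1 β.2).markov _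
  have h0 : (0 : Ordinal.{u}) < o := ho.bot_lt
  obtain ⟨η, hη, h⟩ := exists_limit_kernel (A := fun α : Set.Iio o => M.slice S α.1 o) (κ := κ)
    (fun α β hαβ v hv => ⟨hv.1, le_trans hαβ hv.2.1, hv.2.2⟩)
    (fun v => by
      by_cases hv : M.depth v < o
      · exact ⟨⟨M.depth v + 1, ho.add_one_lt hv⟩, fun h =>
          h.2.1.not_gt (Order.lt_add_one_iff.2 le_rfl)⟩
      · exact ⟨⟨0, h0⟩, fun h => hv h.2.2⟩)
    (fun α β => ((ih β.1 β.2).fixes _).mono (Set.compl_subset_compl.2 fun v hv =>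
      ⟨⟨hv.1.1, hv.1.2, hv.2.2.trans β.2⟩, fun h => h.2.1.not_gt hv.2.2⟩))
    (fun α β γ hαβ hβγ => by
      have := (ih γ.1 γ.2).comp (M.above S α.1) β.1 hβγ
      rwa [M.above_above S hαβ] at this)
    (b := ⟨0, h0⟩) (fun α => zero_le (a := α.1))
  refine ⟨η, hη, fun α hα x E hE hEα => ?_⟩
  have := h ⟨α, hα⟩ x E hE hEα
  simpa only [κ, M.above_zero] using this

theorem isKernelLimit_cascade_of_spec {o : Ordinal.{u}} (ho : Order.IsSuccLimit o)
    (ih : ∀ β < o, M.CascadeSpec β) (S : Set V) :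
    M.IsKernelLimit S o (fun α _ => M.cascade α S) (M.cascade o S) :=
  M.isKernelLimit_cascade ho (M.exists_isKernelLimit ho ih S)

theorem cascadeSpec_zero : M.CascadeSpec 0 where
  markov S := by rw [cascade_zero]; infer_instance
  fixes S x := by
    rw [cascade_zero, Kernel.id_apply, Measure.map_dirac' (measurable_merge _ _)]
    congr 1
    funext v
    simp [merge]
  comp S α hα := by
    obtain rfl : α = 0 := le_antisymm hα zero_le
    simp only [cascade_zero, Kernel.id_comp]

theorem cascadeSpec_add_one {β : Ordinal.{u}} (ih : M.CascadeSpec β) :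
    M.CascadeSpec (β + 1) := by
  have hm : ∀ S, IsMarkovKernel (M.cascade (β + 1) S) := fun S => by
    have := ih.markov S
    rw [cascade_add_one]
    infer_instance
  have hf : ∀ S, Fixes (M.cascade (β + 1) S) (M.slice S 0 (β + 1))ᶜ := fun S => by
    rw [cascade_add_one]
    refine ((M.fixes_resample _).mono (Set.compl_subset_compl.2 fun v hv => ?_)).comp
      ((ih.fixes S).mono (Set.compl_subset_compl.2 fun v hv => ?_))
    · exact ⟨hv.1, zero_le, Order.lt_add_one_iff.2 hv.2.le⟩
    · exact ⟨hv.1, zero_le, Order.lt_add_one_iff.2 hv.2.2.le⟩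
  refine ⟨hm, hf, fun S α hα => ?_⟩
  rcases hα.eq_or_lt with rfl | hα
  · rw [M.cascade_above_self hm hf, Kernel.id_comp]
  · have hα := Order.lt_add_one_iff.1 hα
    rw [cascade_add_one, cascade_add_one, M.layer_above S hα, Kernel.comp_assoc,
      ← ih.comp S α hα]

/-- Tested on events that ignore the depths in `[β, o)`, the limit kernel may be replaced by
`cascade β`, for which the properties are known. -/
theorem cascadeSpec_limit {o : Ordinal.{u}} (ho : Order.IsSuccLimit o)
    (ih : ∀ β < o, M.CascadeSpec β) : M.CascadeSpec o := by
  have hm : ∀ S, IsMarkovKernel (M.cascade o S) := fun S =>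
    (M.isKernelLimit_cascade_of_spec ho ih S).1
  have hlim : ∀ S α, α < o → ∀ x, AgreeOn (M.slice S α o)ᶜ (M.cascade o S x) (M.cascade α S x) :=
    fun S => (M.isKernelLimit_cascade_of_spec ho ih S).2
  have h0 : (0 : Ordinal.{u}) < o := ho.bot_lt
  have hf : ∀ S, Fixes (M.cascade o S) (M.slice S 0 o)ᶜ := fun S x => by
    have hmm := measurable_merge (X := X) (M.slice S 0 o)ᶜ x
    have := Measure.isProbabilityMeasure_map (μ := M.cascade o S x) hmm.aemeasurable
    refine AgreeOn.eq (M.agreeOn_of_slice ho S _ h0 fun β _ hβ E hE hEβ => ?_)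
    replace hEβ : DependsOn (· ∈ E) (M.slice S β o)ᶜ := hEβ.mono fun v hv => hv.2
    have hfix := ((ih β hβ).fixes S).mono (C' := (M.slice S 0 o)ᶜ)
      (Set.compl_subset_compl.2 fun v hv => ⟨hv.1, hv.2.1, hv.2.2.trans hβ⟩)
    rw [Measure.map_apply hmm hE, hlim S β hβ x E hE hEβ,
      hlim S β hβ x _ (hmm hE) fun y z hyz => ?_, ← Measure.map_apply hmm hE, hfix x]
    refine hEβ fun v hv => ?_
    by_cases hv' : v ∈ (M.slice S 0 o)ᶜ
    · rw [merge_of_mem _ _ hv', merge_of_mem _ _ hv']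
    · rw [merge_of_notMem _ _ hv', merge_of_notMem _ _ hv', hyz v hv]
  refine ⟨hm, hf, fun S α hα => ?_⟩
  rcases hα.eq_or_lt with rfl | hα
  · rw [M.cascade_above_self hm hf, Kernel.id_comp]
  · ext1 x
    have := (ih α hα).markov S
    refine AgreeOn.eq (M.agreeOn_of_slice ho S _ hα fun β hαβ hβ E hE hEβ => ?_)
    replace hEβ : DependsOn (· ∈ E) (M.slice S β o)ᶜ := hEβ.mono fun v hv => hv.2
    rw [hlim S β hβ x E hE hEβ, (ih β hβ).comp S α hαβ, Kernel.comp_apply' _ _ _ hE,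
      Kernel.comp_apply' _ _ _ hE]
    have hsub : M.slice (M.above S α) β o ⊆ M.slice S β o := fun v hv => ⟨hv.1.1, hv.2⟩
    exact lintegral_congr fun y => (hlim (M.above S α) β hβ y E hE
      (hEβ.mono (Set.compl_subset_compl.2 hsub))).symm

theorem cascadeSpec (β : Ordinal.{u}) : M.CascadeSpec β := by
  induction β using Ordinal.limitRecOn with
  | zero => exact M.cascadeSpec_zero
  | add_one β ih => exact M.cascadeSpec_add_one ih
  | limit o ho ih => exact M.cascadeSpec_limit ho ih

instance (β : Ordinal.{u}) (S : Set V) : IsMarkovKernel (M.cascade β S) :=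
  (M.cascadeSpec β).markov S

/-- Resampling the vertices of depth at least `α` does not change the others. -/
theorem cascade_agreeOn_of_le (S : Set V) {α β : Ordinal.{u}} (h : α ≤ β) (x : ∀ v, X v) :
    AgreeOn (M.slice S α β)ᶜ (M.cascade β S x) (M.cascade α S x) := by
  intro E hE hEC
  rw [(M.cascadeSpec β).comp S α h, Kernel.comp_apply' _ _ _ hE]
  have hsub : M.slice (M.above S α) 0 β ⊆ M.slice S α β := fun v hv =>
    ⟨hv.1.1, hv.1.2, hv.2.2⟩
  exact (lintegral_congr fun y => ((M.cascadeSpec β).fixes (M.above S α)).apply_eq y hE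
    (hEC.mono (Set.compl_subset_compl.2 hsub))).trans
    (lintegral_indicator_one hE)

theorem nonempty_config (M : MTBN V X) : Nonempty (∀ v, X v) := by
  have : ∀ v, Nonempty (X v) := fun v => by
    induction v using IsWellFounded.induction M.E with
    | ind v ih =>
      have : ∀ u : {u | M.E u v}, Nonempty (X u) := fun u => ih u u.2
      exact (M.K v fun u => (this u).some).nonempty_of_neZero
  exact ⟨fun v => (this v).some⟩

theorem measurable_domRestrict (C : Set V) : Measurable (C.domRestrict (π := X)) := by
  fun_prop

theorem _root_.AgreeOn.map_domRestrict {C : Set V} {μ ν : Measure (∀ v, X v)}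
    (h : AgreeOn C μ ν) : μ.map (C.domRestrict (π := X)) = ν.map (C.domRestrict (π := X)) :=
  h.map_eq (measurable_domRestrict C) (dependsOn_domRestrict C)

theorem map_domRestrict₂_map_domRestrict {C C' : Set V} (h : C ⊆ C') (μ : Measure (∀ v, X v)) :
    (μ.map (C'.domRestrict (π := X))).map (Set.domRestrict₂ (π := X) h) =
      μ.map (C.domRestrict (π := X)) :=
  Measure.map_map (Set.measurable_restrict₂ h) (measurable_domRestrict C')

theorem prodK_domRestrict {W S : Set V} (h : ∀ v ∈ S, M.pa v ⊆ W) (x : ∀ v, X v) :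
    M.prodK h (W.domRestrict x) = (M.resample S x).map (S.domRestrict (π := X)) := by
  rw [resample_apply, Measure.infinitePi_map_restrict']
  exact infinitePi_congr fun v => (M.siteK_of_mem v.2 x).symm

/-- This translates the product construction into resampling: as `S` misses `W`, the redraw leaves
the `W`-part intact and supplies the `S`-part. -/
theorem extend_map_domRestrict {W S U : Set V} (hU : U = W ∪ S) (hd : Disjoint W S)
    (h : ∀ v ∈ S, M.pa v ⊆ W) (μ : Measure (∀ v, X v)) [IsProbabilityMeasure μ] :
    M.extend hU h (μ.map (W.domRestrict (π := X))) =
      (M.resample S ∘ₘ μ).map (U.domRestrict (π := X)) := by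
  have : IsMarkovKernel (M.prodK h) := inferInstanceAs (IsMarkovKernel (kernelPi _))
  have := Measure.isProbabilityMeasure_map (μ := μ) (measurable_domRestrict (X := X) W).aemeasurable
  ext B hB
  have hB' := measurable_glue (X := X) hU hB
  rw [extend, Measure.map_apply (measurable_glue hU) hB, Measure.compProd_apply hB',
    lintegral_map (Kernel.measurable_kernel_prodMk_left hB') (measurable_domRestrict W),
    Measure.map_apply (measurable_domRestrict U) hB,
    Measure.bind_apply (measurable_domRestrict U hB) (Kernel.aemeasurable _)]
  refine lintegral_congr fun x => ?_
  rw [prodK_domRestrict, Measure.map_apply (measurable_domRestrict S) (measurable_prodMk_left hB'),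
    ← M.fixes_resample S x, Measure.map_apply (measurable_merge _ _)
      (measurable_domRestrict S (measurable_prodMk_left hB')),
    Measure.map_apply (measurable_merge _ _) (measurable_domRestrict U hB)]
  congr 1
  ext y
  have : glue hU (W.domRestrict x, S.domRestrict (merge Sᶜ x y)) =
      U.domRestrict (merge Sᶜ x y) := by
    funext v
    by_cases hv : v.1 ∈ W
    · have : v.1 ∈ Sᶜ := Set.disjoint_left.1 hd hv
      simp [glue, hv, merge_of_mem _ _ this]
    · simp [glue, hv]
  simp only [Set.mem_preimage, this]

/-! ### The recursion as marginals of the cascade. -/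

theorem muStage_zero (U : M.Lam) :
    M.muStage U 0 = Measure.dirac fun a : M.below U 0 => absurd a.2.2 not_lt_zero := by
  rw [muStage, Ordinal.limitRecOn_zero]

theorem muStage_add_one (U : M.Lam) (α : Ordinal.{u}) :
    M.muStage U (α + 1) =
      M.extend (M.below_succ U α) (M.pa_subset_below U α) (M.muStage U α) := by
  rw [muStage, Ordinal.limitRecOn_add_one]
  rfl

theorem muStage_limit (U : M.Lam) {o : Ordinal.{u}} (ho : Order.IsSuccLimit o) :
    M.muStage U o = M.limitMeasure U o fun α _ => M.muStage U α := by
  rw [muStage, Ordinal.limitRecOn_limit _ _ _ _ ho]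
  rfl

/-- Any finite set of coordinates in `U^o` lies in some `U^α` with `α < o`, so the prescribed
marginals determine all finite-dimensional ones. -/
theorem IsLimit.unique {U : M.Lam} {o : Ordinal.{u}} (ho : Order.IsSuccLimit o)
    {ν : ∀ α < o, Measure (∀ a : M.below U α, X a)} {ρ ρ' : Measure (∀ a : M.below U o, X a)}
    [IsFiniteMeasure ρ'] (h : M.IsLimit U o ν ρ) (h' : M.IsLimit U o ν ρ') : ρ = ρ' := by
  classical
  refine IsProjectiveLimit.unique
    (P := fun I : Finset (M.below U o) => ρ'.map I.restrict) (fun I => ?_) fun I => rfl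
  obtain ⟨α, -, hα, hI⟩ := M.exists_lt_forall_depth_lt ho (I.map (.subtype _)) ho.bot_lt
  have hI' : ∀ i : I, i.1.1 ∈ M.below U α := fun i =>
    ⟨i.1.2.1, hI i.1.1 (Finset.mem_map_of_mem _ i.2) i.1.2.2⟩
  let g : (∀ a : M.below U α, X a) → ∀ i : I, X i.1 := fun y i => y ⟨i.1.1, hI' i⟩
  have hg : Measurable g := by fun_prop
  have hm := Set.measurable_restrict₂ (X := X) (M.below_mono U hα.le)
  have key : ∀ τ : Measure (∀ a : M.below U o, X a),
      τ.map I.restrict = (τ.map (Set.domRestrict₂ (π := X) (M.below_mono U hα.le))).map g :=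
    fun τ => (Measure.map_map hg hm).symm
  change ρ.map I.restrict = ρ'.map I.restrict
  rw [key, key, ← h α hα, ← h' α hα]

theorem below_subset_compl_slice (U : M.Lam) (α β : Ordinal.{u}) :
    M.below U α ⊆ (M.slice U.1 α β)ᶜ := fun _ hv h => h.2.1.not_gt hv.2

theorem isLimit_cascade (U : M.Lam) (o : Ordinal.{u}) (x : ∀ v, X v) :
    M.IsLimit U o (fun α _ => (M.cascade α U.1 x).map ((M.below U α).domRestrict (π := X)))
      ((M.cascade o U.1 x).map ((M.below U o).domRestrict (π := X))) := by
  intro α hα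
  rw [map_domRestrict₂_map_domRestrict]
  exact (((M.cascade_agreeOn_of_le U.1 hα.le x).mono
    (M.below_subset_compl_slice U α o)).map_domRestrict).symm

theorem existsUnique_isLimit_cascade (U : M.Lam) {o : Ordinal.{u}} (ho : Order.IsSuccLimit o)
    (x : ∀ v, X v) :
    ∃! ρ, M.IsLimit U o
      (fun α _ => (M.cascade α U.1 x).map ((M.below U α).domRestrict (π := X))) ρ := by
  have := Measure.isProbabilityMeasure_map (μ := M.cascade o U.1 x)
    (measurable_domRestrict (X := X) (M.below U o)).aemeasurable
  exact ⟨_, M.isLimit_cascade U o x, fun ρ hρ => hρ.unique M ho (M.isLimit_cascade U o x)⟩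

theorem limitMeasure_eq {U : M.Lam} {o : Ordinal.{u}}
    {ν : ∀ α < o, Measure (∀ a : M.below U α, X a)} (h : ∃! ρ, M.IsLimit U o ν ρ)
    {ρ : Measure (∀ a : M.below U o, X a)} (hρ : M.IsLimit U o ν ρ) :
    M.limitMeasure U o ν = ρ := by
  rw [limitMeasure, dif_pos h]
  exact h.unique h.choose_spec.1 hρ

theorem muStage_eq_map_cascade (U : M.Lam) (x : ∀ v, X v) (α : Ordinal.{u}) :
    M.muStage U α = (M.cascade α U.1 x).map ((M.below U α).domRestrict (π := X)) := by
  induction α using Ordinal.limitRecOn with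
  | zero =>
    rw [muStage_zero, cascade_zero, Kernel.id_apply,
      Measure.map_dirac' (measurable_domRestrict _)]
    congr 1
    funext a
    exact absurd a.2.2 not_lt_zero
  | add_one α ih =>
    rw [muStage_add_one, ih, M.extend_map_domRestrict, cascade_add_one, Kernel.comp_apply]
    · rfl
    · exact Set.disjoint_left.2 fun v hv hv' => hv.2.ne hv'.2
  | limit o ho ih =>
    have : (fun α (_ : α < o) => M.muStage U α) =
        fun α _ => (M.cascade α U.1 x).map ((M.below U α).domRestrict (π := X)) :=
      funext₂ ih
    rw [M.muStage_limit U ho, this]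
    exact M.limitMeasure_eq (M.existsUnique_isLimit_cascade U ho x) (M.isLimit_cascade U o x)

theorem isProjectiveSequence_muStage (U : M.Lam) (o : Ordinal.{u}) :
    M.IsProjectiveSequence U o fun α _ => M.muStage U α := by
  obtain ⟨x⟩ := M.nonempty_config
  intro α β _ _ h
  change M.muStage U α = (M.muStage U β).map _
  rw [M.muStage_eq_map_cascade U x, M.muStage_eq_map_cascade U x]
  exact M.isLimit_cascade U β x α h

theorem existsUnique_isLimit_muStage (U : M.Lam) {o : Ordinal.{u}} (ho : Order.IsSuccLimit o) :
    ∃! ρ, M.IsLimit U o (fun α _ => M.muStage U α) ρ := by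
  obtain ⟨x⟩ := M.nonempty_config
  simpa only [M.muStage_eq_map_cascade U x] using M.existsUnique_isLimit_cascade U ho x

theorem mu_eq_map_cascade (U : M.Lam) (x : ∀ v, X v) :
    M.mu U = (M.cascade M.D U.1 x).map (U.1.domRestrict (π := X)) := by
  rw [mu, M.muStage_eq_map_cascade U x, map_domRestrict₂_map_domRestrict]

/-! ### Projectivity and consistency. -/

/-- The law of a parent-closed set of vertices is not affected by resampling further vertices. -/
theorem cascade_agreeOn_of_subset {W U : Set V} (h : W ⊆ U) (hW : ∀ v ∈ W, M.pa v ⊆ W)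
    (x : ∀ v, X v) (α : Ordinal.{u}) : AgreeOn W (M.cascade α U x) (M.cascade α W x) := by
  induction α using Ordinal.limitRecOn with
  | zero =>
    rw [cascade_zero, cascade_zero]
    exact fun _ _ _ => rfl
  | add_one α ih =>
    intro E hE hEW
    rw [cascade_add_one, cascade_add_one, Kernel.comp_apply' _ _ _ hE,
      Kernel.comp_apply' _ _ _ hE]
    have hres : ∀ y, M.resample (M.layer U α) y E = M.resample (M.layer W α) y E := fun y =>
      M.agreeOn_resample (C := W)
        (fun v hv => M.siteK_congr (S := M.layer U α) (S' := M.layer W α)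
          ⟨fun h' => ⟨hv, h'.2⟩, fun h' => ⟨h hv, h'.2⟩⟩
        (fun _ _ _ => rfl) fun _ => rfl) E hE hEW
    simp_rw [hres]
    refine ih.lintegral_eq (Kernel.measurable_coe _ hE) fun y z hyz => ?_
    exact M.agreeOn_resample (fun v hv => M.siteK_congr Iff.rfl
      (fun _ u hu => hyz u (hW v hv hu)) fun _ => hyz v hv) E hE hEW
  | limit o ho ih =>
    refine M.agreeOn_of_slice ho U W ho.bot_lt fun β _ hβ => ?_
    have hU := (M.cascade_agreeOn_of_le U hβ.le x).mono (C' := W \ M.slice U β o) fun v hv => hv.2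
    have hW' := (M.cascade_agreeOn_of_le W hβ.le x).mono (C' := W \ M.slice U β o)
      fun v hv hv' => hv.2 ⟨h hv'.1, hv'.2⟩
    exact (hU.trans ((ih β hβ).mono Set.sdiff_subset)).trans hW'.symm

/-- If `W` contains the parents of all the vertices of `U`, then the vertices of `U \ W` can be
resampled all at once. -/
theorem cascade_eq_resample_comp {W U : Set V} (h : W ⊆ U) (hpa : ∀ v ∈ U, M.pa v ⊆ W)
    (α : Ordinal.{u}) :
    M.cascade α U = M.resample (M.slice (U \ W) 0 α) ∘ₖ M.cascade α W := by
  induction α using Ordinal.limitRecOn with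
  | zero =>
    have : M.resample (M.slice (U \ W) 0 0) = Kernel.id :=
      Fixes.eq_id ((M.fixes_resample _).mono fun v _ hv => hv.2.2.not_ge hv.2.1)
    rw [this, cascade_zero, cascade_zero, Kernel.id_comp]
  | add_one α ih =>
    -- Both sides become one simultaneous redraw of the same set after `cascade α W`. The merges are
    -- allowed because parents of `U` are never in `U \ W`, and parents of vertices of depth at most
    -- `α` have depth less than `α`.
    rw [cascade_add_one, cascade_add_one, ih, ← Kernel.comp_assoc, ← Kernel.comp_assoc,
      resample_comp_resample, resample_comp_resample]
    · congr 2
      ext v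
      have := @h v
      simp only [slice, layer, Set.mem_union, Set.mem_ofPred_eq, Set.mem_sdiff, zero_le, true_and,
        Order.lt_add_one_iff, le_iff_lt_or_eq (a := M.depth v)]
      tauto
    · exact fun v hv => Set.disjoint_left.2 fun u hu hu' =>
        ((M.depth_lt_of_edge hu).trans_le (Order.lt_add_one_iff.1 hv.2.2)).ne hu'.2
    · exact fun v hv => Set.disjoint_left.2 fun u hu hu' => hu'.1.2 (hpa v hv.1 hu)
  | limit o ho ih =>
    ext1 x
    refine AgreeOn.eq (M.agreeOn_of_slice ho U _ ho.bot_lt fun β _ hβ E hE hEβ => ?_)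
    replace hEβ : DependsOn (· ∈ E) (M.slice U β o)ᶜ := hEβ.mono fun v hv => hv.2
    rw [M.cascade_agreeOn_of_le U hβ.le x E hE hEβ, ih β hβ, Kernel.comp_apply' _ _ _ hE,
      Kernel.comp_apply' _ _ _ hE]
    have hres : ∀ y, M.resample (M.slice (U \ W) 0 o) y E =
        M.resample (M.slice (U \ W) 0 β) y E := fun y =>
      M.agreeOn_resample (C := (M.slice U β o)ᶜ) (fun v hv => M.siteK_congr
        (S := M.slice (U \ W) 0 o) (S' := M.slice (U \ W) 0 β)
        ⟨fun h' => ⟨h'.1, h'.2.1, lt_of_not_ge fun hle => hv ⟨h'.1.1, hle, h'.2.2⟩⟩,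
          fun h' => ⟨h'.1, h'.2.1, h'.2.2.trans hβ⟩⟩
        (fun _ _ _ => rfl) fun _ => rfl) E hE hEβ
    simp_rw [hres]
    refine ((M.cascade_agreeOn_of_le W hβ.le x).lintegral_eq (Kernel.measurable_coe _ hE)
      fun y z hyz => ?_).symm
    exact M.agreeOn_resample (C := (M.slice U β o)ᶜ) (fun v hv => M.siteK_congr Iff.rfl
      (fun h' u hu => hyz u fun hu' =>
        ((M.depth_lt_of_edge hu).trans h'.2.2).not_ge hu'.2.1)
      fun _ => hyz v fun hv' => hv ⟨h hv'.1, hv'.2⟩) E hE hEβ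

theorem isProjectiveFamily_mu : M.IsProjectiveFamily M.mu := by
  obtain ⟨x⟩ := M.nonempty_config
  refine ⟨fun U => ?_, fun W U h => ?_⟩
  · rw [M.mu_eq_map_cascade U x]
    exact Measure.isProbabilityMeasure_map (measurable_domRestrict _).aemeasurable
  · rw [M.mu_eq_map_cascade U x, M.mu_eq_map_cascade W x, map_domRestrict₂_map_domRestrict]
    exact ((M.cascade_agreeOn_of_subset h W.2 x M.D).map_domRestrict).symm

theorem isConsistent_mu : M.IsConsistent M.mu := by
  obtain ⟨x⟩ := M.nonempty_config
  intro W U h hpa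
  have hslice : M.slice (U.1 \ W.1) 0 M.D = U.1 \ W.1 :=
    Set.ext fun v => ⟨fun hv => hv.1, fun hv => ⟨hv, zero_le, M.depth_lt_D v⟩⟩
  rw [M.mu_eq_map_cascade U x, M.mu_eq_map_cascade W x,
    M.extend_map_domRestrict _ Set.disjoint_sdiff_right, M.cascade_eq_resample_comp h hpa, hslice,
    Kernel.comp_apply]

/-! ### Uniqueness of the consistent projective family. -/

/-- The parent-closed set `U^α`. -/
def belowLam (U : M.Lam) (α : Ordinal.{u}) : M.Lam :=
  ⟨M.below U α, fun v hv _ ha => ⟨U.2 v hv.1 ha, (M.depth_lt_of_edge ha).trans hv.2⟩⟩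

theorem extend_congr {W S S' U : Set V} (hS : S = S') (hU : U = W ∪ S) (hU' : U = W ∪ S')
    (h : ∀ v ∈ S, M.pa v ⊆ W) (h' : ∀ v ∈ S', M.pa v ⊆ W) (μ : Measure (∀ a : W, X a)) :
    M.extend hU h μ = M.extend hU' h' μ := by
  subst hS
  rfl

theorem eq_muStage_of_isConsistent {μ : ∀ U : M.Lam, Measure (∀ a : U.1, X a)}
    (hp : M.IsProjectiveFamily μ) (hc : M.IsConsistent μ) (U : M.Lam) (α : Ordinal.{u}) :
    μ (M.belowLam U α) = M.muStage U α := by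
  induction α using Ordinal.limitRecOn with
  | zero =>
    have := hp.1 (M.belowLam U 0)
    have : IsEmpty (M.belowLam U 0).1 := ⟨fun a => not_lt_zero a.2.2⟩
    rw [muStage_zero]
    refine Measure.ext fun E _ => ?_
    rcases E.eq_empty_or_nonempty with rfl | hE
    · exact measure_empty.trans measure_empty.symm
    · rw [Subsingleton.eq_univ_of_nonempty hE]
      exact measure_univ.trans measure_univ.symm
  | add_one α ih =>
    have hle : α ≤ α + 1 := (Order.lt_add_one_iff.2 le_rfl).le
    rw [muStage_add_one, ← ih]
    -- Parents of vertices in `U^(α+1)` lie in `U^α`, so consistency applies to this pair and gives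
    -- the successor step.
    refine (hc (M.belowLam U α) (M.belowLam U (α + 1)) (M.below_mono U hle) fun u hu _ ha =>
      ⟨U.2 u hu.1 ha, (M.depth_lt_of_edge ha).trans_le (Order.lt_add_one_iff.1 hu.2)⟩).trans ?_
    refine M.extend_congr (Set.ext fun v => ?_) _ _ _ _ _
    exact ⟨fun hv => ⟨hv.1.1, le_antisymm (Order.lt_add_one_iff.1 hv.1.2)
      (not_lt.1 fun hlt => hv.2 ⟨hv.1.1, hlt⟩)⟩,
      fun hv => ⟨⟨hv.1, Order.lt_add_one_iff.2 hv.2.le⟩, fun hv' => hv'.2.ne hv.2⟩⟩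
  | limit o ho ih =>
    rw [M.muStage_limit U ho]
    -- Projectivity makes the member at `U^o` a limit of the earlier stages, and that limit is
    -- unique.
    refine (M.limitMeasure_eq (M.existsUnique_isLimit_muStage U ho) fun α hα => ?_).symm
    exact (ih α hα).symm.trans
      (hp.2 (M.belowLam U α) (M.belowLam U o) (M.below_mono U hα.le))

theorem eq_mu_of_isConsistent {μ : ∀ U : M.Lam, Measure (∀ a : U.1, X a)}
    (hp : M.IsProjectiveFamily μ) (hc : M.IsConsistent μ) : μ = M.mu := by
  funext U
  rw [mu, ← M.eq_muStage_of_isConsistent hp hc U M.D]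
  exact hp.2 U (M.belowLam U M.D) (M.subset_below_D U)

end MTBN

theorem mainTheorem2 {V : Type u} {X : V → Type w} [∀ v, MeasurableSpace (X v)] (M : MTBN V X) :
    -- the limits in the transfinite recursion exist and are unique
    (∀ (U : M.Lam) (o : Ordinal.{u}), Order.IsSuccLimit o →
      M.IsProjectiveSequence U o (fun α _ => M.muStage U α) ∧
      ∃! ρ, M.IsLimit U o (fun α _ => M.muStage U α) ρ) ∧
    -- the resulting family is a projective family of probability measures consistent with `M`
    M.IsProjectiveFamily M.mu ∧ M.IsConsistent M.mu ∧
    -- and it is the only one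
    ∀ μ : (∀ U : M.Lam, Measure (∀ a : U.1, X a)),
      M.IsProjectiveFamily μ → M.IsConsistent μ → μ = M.mu :=
  ⟨fun U o ho => ⟨M.isProjectiveSequence_muStage U o, M.existsUnique_isLimit_muStage U ho⟩,
    M.isProjectiveFamily_mu, M.isConsistent_mu, fun _ => M.eq_mu_of_isConsistent⟩
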